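/- Let $P_0,P_1,P_2,P_3\in\mathbb R^3$ be affinely independent, let $f_i(X)=\tfrac12(X+P_i)$ for $0\le i\le 3$, and let $\mathfrak{ST}$ be the Sierpiński tetrahedron with corners $P_0,\dots,P_3$, i.e. the unique non-empty compact set with $\mathfrak{ST}=\bigcup_{i=0}^3 f_i(\mathfrak{ST})$. Put $V_0=\{P_0,\dots,P_3\}$ and $V_{m+1}=\bigcup_{i=0}^3 f_i(V_m)$. For $m\ge 0$ write $X\sim_m Y$ if $X\ne Y$ and $X,Y\in f_{i_1}\circ\dots\circ f_{i_m}(V_0)$ for some $i_1,\dots,i_m\in\{0,1,2,3\}$. Let $r=\tfrac23$ and let $\mu$ be the self-similar Borel probability measure on $\mathfrak{ST}$ with equal weights, $\mu=\tfrac14\sum_{i=0}^3\mu\circ f_i^{-1}$. For continuous $u,v:\mathfrak{ST}\to\mathbb R$ let $$\mathcal E_m(u,v)=r^{-m}\sum_{X\sim_m Y}(u(X)-u(Y))(v(X)-v(Y)),\qquad \mathcal E(u,v)=\lim_{m\to\infty}\mathcal E_m(u,v),$$ where each unordered pair $\{X,Y\}$ with $X\sim_m Y$ counts once. Let $\operatorname{dom}\mathcal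 E$ be the set of continuous $u$ on $\mathfrak{ST}$ for which $\mathcal E(u,u)$ exists and is finite, and let $\operatorname{dom}_0\mathcal E$ be the set of those $u\in\operatorname{dom}\mathcal E$ that vanish on $V_0$. A function $u\in\operatorname{dom}\mathcal E$ belongs to $\operatorname{dom}\Delta$ if there is a continuous function $\Delta u$ on $\mathfrak{ST}$ (a Laplacian of $u$) such that $\mathcal E(u,v)=-\int_{\mathfrak{ST}} v\,\Delta u\,d\mu$ for all $v\in\operatorname{dom}_0\mathcal E$. The normal derivative of a continuous $u$ at $X\in\mathfrak{ST}$ is $$\partial_n u(X)=\lim_{m\to\infty} r^{-m}\sum_{Y\in V_m,\;Y\sim_m X}(u(X)-u(Y)),$$ if this limit exists in $\mathbb R$ (an empty sum is $0$, so that the notion has content only for $X\in\bigcup_m V_m$). **Theorem.** Let $u\in\operatorname{dom}\Delta$. Then $\partial_n u(X)$ exists for every $X\in\mathfrak{ST}$. Moreover, for every $v\in\operatorname{dom}\mathcal E$ the limit $\mathcal E(u,v)$ exists, and the Gauss–Green formula holds: $$\mathcal E(u,v)=-\int_{\mathfrak{ST}}(\Delta u)\,v\,d\mu+\sum_{X\in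 V_0}v(X)\,\partial_n u(X).$$ -/

import Mathlib

open MeasureTheory Filter Topology

namespace SierpinskiTetrahedron

noncomputable section

/-- Euclidean three-space. -/
abbrev E3 : Type := EuclideanSpace ℝ (Fin 3)

/-- The contraction `f_i(X) = (X + P_i) / 2`. -/
def f (P : Fin 4 → E3) (i : Fin 4) (X : E3) : E3 := (1 / 2 : ℝ) • (X + P i)

/-- The point with address `ω`, that is `lim_n f_{ω 0} ∘ ⋯ ∘ f_{ω n} (0) = ∑ₙ 2^{-(n+1)} P_{ω n}`. -/
def code (P : Fin 4 → E3) (ω : ℕ → Fin 4) : E3 := ∑' n : ℕ, (1 / 2 : ℝ) ^ (n + 1) • P (ω n)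

/-- The Sierpiński tetrahedron with corners `P_0, …, P_3`: the attractor of `f_0, …, f_3`. By
`isCompact_carrier`, `carrier_nonempty`, `carrier_selfSimilar` and `carrier_unique` below it is the
unique non-empty compact set `K` with `K = ⋃ i, f_i(K)`. -/
def carrier (P : Fin 4 → E3) : Set E3 := Set.range (code P)

/-- The Sierpiński tetrahedron as a topological space. -/
abbrev Tet (P : Fin 4 → E3) : Type := ↥(carrier P)

theorem norm_code_term_le (P : Fin 4 → E3) (ω : ℕ → Fin 4) (n : ℕ) :
    ‖(1 / 2 : ℝ) ^ (n + 1) • P (ω n)‖ ≤ (1 / 2 : ℝ) ^ (n + 1) * ∑ i, ‖P i‖ := by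
  rw [norm_smul, norm_pow, Real.norm_of_nonneg (by norm_num : (0 : ℝ) ≤ 1 / 2)]
  gcongr
  exact Finset.single_le_sum (f := fun i => ‖P i‖) (fun i _ => norm_nonneg _) (Finset.mem_univ _)

theorem summable_bound (P : Fin 4 → E3) :
    Summable fun n : ℕ => (1 / 2 : ℝ) ^ (n + 1) * ∑ i, ‖P i‖ :=
  ((summable_nat_add_iff 1).2 summable_geometric_two).mul_right _

theorem summable_code (P : Fin 4 → E3) (ω : ℕ → Fin 4) :
    Summable fun n : ℕ => (1 / 2 : ℝ) ^ (n + 1) • P (ω n) :=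
  Summable.of_norm_bounded (summable_bound P) (norm_code_term_le P ω)

theorem continuous_code (P : Fin 4 → E3) : Continuous (code P) := by
  refine continuous_tsum (fun n => ?_) (summable_bound P) (fun n ω => norm_code_term_le P ω n)
  have h : Continuous fun ω : ℕ → Fin 4 => P (ω n) :=
    (continuous_of_discreteTopology (f := P)).comp (continuous_apply (A := fun _ : ℕ => Fin 4) n)
  exact Continuous.const_smul h ((1 / 2 : ℝ) ^ (n + 1))

theorem code_eq_f (P : Fin 4 → E3) (ω : ℕ → Fin 4) :
    code P ω = f P (ω 0) (code P fun n => ω (n + 1)) := by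
  unfold code f
  rw [(summable_code P ω).tsum_eq_zero_add, smul_add, ← tsum_const_smul'', add_comm]
  congr 1
  · refine tsum_congr fun n => ?_
    rw [smul_smul]
    congr 1
    ring
  · simp

/-- Prefixing an address by a letter. -/
def cons (i : Fin 4) (ω : ℕ → Fin 4) : ℕ → Fin 4
  | 0 => i
  | n + 1 => ω n

theorem code_cons (P : Fin 4 → E3) (i : Fin 4) (ω : ℕ → Fin 4) :
    code P (cons i ω) = f P i (code P ω) := by
  rw [code_eq_f]; rfl

theorem f_mem (P : Fin 4 → E3) (i : Fin 4) {X : E3} (hX : X ∈ carrier P) : f P i X ∈ carrier P := by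
  obtain ⟨ω, rfl⟩ := hX
  exact ⟨cons i ω, code_cons P i ω⟩

theorem corner_mem (P : Fin 4 → E3) (i : Fin 4) : P i ∈ carrier P := by
  refine ⟨fun _ => i, ?_⟩
  have h := code_eq_f P fun _ => i
  simp only [f, smul_add] at h
  have h2 : (1 / 2 : ℝ) • code P (fun _ => i) = (1 / 2 : ℝ) • P i := by
    have : code P (fun _ => i) - (1 / 2 : ℝ) • code P (fun _ => i) = (1 / 2 : ℝ) • P i :=
      sub_eq_of_eq_add' h
    rw [← this]
    module
  exact smul_right_injective E3 (by norm_num : (1 / 2 : ℝ) ≠ 0) h2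

theorem isCompact_carrier (P : Fin 4 → E3) : IsCompact (carrier P) :=
  isCompact_range (continuous_code P)

theorem carrier_nonempty (P : Fin 4 → E3) : (carrier P).Nonempty := ⟨P 0, corner_mem P 0⟩

theorem carrier_selfSimilar (P : Fin 4 → E3) : carrier P = ⋃ i, f P i '' carrier P := by
  ext X
  simp only [Set.mem_iUnion, Set.mem_image]
  constructor
  · rintro ⟨ω, rfl⟩
    exact ⟨ω 0, _, ⟨_, rfl⟩, (code_eq_f P ω).symm⟩
  · rintro ⟨i, Y, hY, rfl⟩
    exact f_mem P i hY

theorem dist_f (P : Fin 4 → E3) (i : Fin 4) (X Y : E3) :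
    dist (f P i X) (f P i Y) = 1 / 2 * dist X Y := by
  unfold f
  rw [dist_smul₀, dist_add_right, Real.norm_of_nonneg (by norm_num)]

theorem carrier_unique (P : Fin 4 → E3) {K : Set E3} (hK : IsCompact K) (hne : K.Nonempty)
    (hs : K = ⋃ i, f P i '' K) : K = carrier P := by
  have hKf : ∀ i, ∀ X ∈ K, f P i X ∈ K := fun i X hX => by
    rw [hs]; exact Set.mem_iUnion.2 ⟨i, X, hX, rfl⟩
  obtain ⟨C, hC⟩ := (Metric.isBounded_iff).1 (hK.isBounded.union (isCompact_carrier P).isBounded)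
  have approx : ∀ (m : ℕ) (ω : ℕ → Fin 4), ∃ X ∈ K, dist X (code P ω) ≤ (1 / 2 : ℝ) ^ m * C := by
    intro m
    induction m with
    | zero =>
      intro ω
      obtain ⟨X, hX⟩ := hne
      exact ⟨X, hX, by simpa using hC (Or.inl hX) (Or.inr ⟨ω, rfl⟩)⟩
    | succ m ih =>
      intro ω
      obtain ⟨X, hX, h⟩ := ih fun n => ω (n + 1)
      refine ⟨f P (ω 0) X, hKf _ _ hX, ?_⟩
      rw [code_eq_f, dist_f, pow_succ']
      linarith
  have approx' : ∀ (m : ℕ), ∀ X ∈ K, ∃ Y ∈ carrier P, dist X Y ≤ (1 / 2 : ℝ) ^ m * C := by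
    intro m
    induction m with
    | zero =>
      intro X hX
      obtain ⟨Y, hY⟩ := carrier_nonempty P
      exact ⟨Y, hY, by simpa using hC (Or.inl hX) (Or.inr hY)⟩
    | succ m ih =>
      intro X hX
      rw [hs] at hX
      obtain ⟨i, X', hX', rfl⟩ := Set.mem_iUnion.1 hX
      obtain ⟨Y, hY, h⟩ := ih X' hX'
      refine ⟨f P i Y, f_mem P i hY, ?_⟩
      rw [dist_f, pow_succ']
      linarith
  have lim : Tendsto (fun m : ℕ => (1 / 2 : ℝ) ^ m * C) atTop (𝓝 0) := by
    simpa using (tendsto_pow_atTop_nhds_zero_of_lt_one (by norm_num : (0 : ℝ) ≤ 1 / 2)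
      (by norm_num)).mul_const C
  apply Set.Subset.antisymm
  · intro X hX
    rw [← (isCompact_carrier P).isClosed.closure_eq, Metric.mem_closure_iff]
    intro ε hε
    obtain ⟨m, hm⟩ := (lim.eventually (gt_mem_nhds hε)).exists
    obtain ⟨Y, hY, h⟩ := approx' m X hX
    exact ⟨Y, hY, h.trans_lt hm⟩
  · rintro _ ⟨ω, rfl⟩
    rw [← hK.isClosed.closure_eq, Metric.mem_closure_iff]
    intro ε hε
    obtain ⟨m, hm⟩ := (lim.eventually (gt_mem_nhds hε)).exists
    obtain ⟨Y, hY, h⟩ := approx m ω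
    exact ⟨Y, hY, by rw [dist_comm]; exact h.trans_lt hm⟩

/-- The contraction `f_i` as a self-map of the Sierpiński tetrahedron. -/
def fTet (P : Fin 4 → E3) (i : Fin 4) (X : Tet P) : Tet P := ⟨f P i X, f_mem P i X.2⟩

/-- The corner `P_i` as a point of the Sierpiński tetrahedron. -/
def corner (P : Fin 4 → E3) (i : Fin 4) : Tet P := ⟨P i, corner_mem P i⟩

/-- The map `f_W = f_{W_1} ∘ ⋯ ∘ f_{W_m}` of a word `W = W_1 ⋯ W_m`. -/
def wordMap (P : Fin 4 → E3) : List (Fin 4) → Tet P → Tet P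
  | [] => id
  | i :: W => fTet P i ∘ wordMap P W

open Classical in
/-- The vertex sets: `V_0 = {P_0, …, P_3}` and `V_{m+1} = ⋃ i, f_i(V_m)`. -/
def V (P : Fin 4 → E3) : ℕ → Finset (Tet P)
  | 0 => Finset.univ.image (corner P)
  | m + 1 => Finset.univ.biUnion fun i => (V P m).image (fTet P i)

/-- The graph of level `m`: two distinct points are adjacent if and only if they are vertices of a
common cell `f_W(V_0)`, for some word `W` of length `m`. -/
def graph (P : Fin 4 → E3) (m : ℕ) : SimpleGraph (Tet P) where
  Adj X Y := X ≠ Y ∧ ∃ W : List (Fin 4), W.length = m ∧ ∃ i j : Fin 4,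
    X = wordMap P W (corner P i) ∧ Y = wordMap P W (corner P j)
  symm := ⟨fun _ _ ⟨h, W, hW, i, j, hX, hY⟩ => ⟨h.symm, W, hW, j, i, hY, hX⟩⟩
  loopless := ⟨fun _ h => h.1 rfl⟩

/-- The energy renormalization factor. -/
def r : ℝ := 2 / 3

open Classical in
/-- The renormalized energy `𝓔_m(u,v) = r^{-m} ∑_{X ∼_m Y} (u(X) - u(Y)) (v(X) - v(Y))` of level `m`.
Each edge counts once, hence the factor `1/2` in front of the sum over ordered pairs. -/
def energyLevel (P : Fin 4 → E3) (m : ℕ) (u v : C(Tet P, ℝ)) : ℝ :=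
  r⁻¹ ^ m * ((1 / 2) * ∑ X ∈ V P m, ∑ Y ∈ V P m with (graph P m).Adj X Y,
    (u X - u Y) * (v X - v Y))

/-- The Dirichlet form `𝓔(u,v) = lim_m 𝓔_m(u,v)` (meaningful where the limit exists). -/
def energy (P : Fin 4 → E3) (u v : C(Tet P, ℝ)) : ℝ :=
  limUnder atTop fun m => energyLevel P m u v

/-- `dom 𝓔`: the continuous functions of finite energy, i.e. such that `lim_m 𝓔_m(u,u)` exists
in `ℝ`. -/
def domE (P : Fin 4 → E3) : Set C(Tet P, ℝ) :=
  {u | ∃ e : ℝ, Tendsto (fun m => energyLevel P m u u) atTop (𝓝 e)}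

/-- `dom₀ 𝓔`: the functions of `dom 𝓔` that vanish on `V_0`. -/
def domE₀ (P : Fin 4 → E3) : Set C(Tet P, ℝ) := {u | u ∈ domE P ∧ ∀ X ∈ V P 0, u X = 0}

/-- The uniform probability on the four letters. -/
abbrev letterLaw : Measure (Fin 4) := (PMF.uniformOfFintype (Fin 4)).toMeasure

/-- The self-similar probability measure `μ` on the Sierpiński tetrahedron with weights
`μ_i = 1/4`: the law of the point whose address is a sequence of independent uniform letters.
`mu_selfSimilar` below is the relation `μ = ∑ i, (1/4) μ ∘ f_i⁻¹`. -/
def mu (P : Fin 4 → E3) : Measure (Tet P) :=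
  (Measure.infinitePi fun _ : ℕ => letterLaw).map fun ω => ⟨code P ω, Set.mem_range_self ω⟩

theorem measurable_codeTet (P : Fin 4 → E3) :
    Measurable fun ω : ℕ → Fin 4 => (⟨code P ω, Set.mem_range_self ω⟩ : Tet P) :=
  (continuous_code P).measurable.subtype_mk

instance (P : Fin 4 → E3) : IsProbabilityMeasure (mu P) :=
  Measure.isProbabilityMeasure_map (measurable_codeTet P).aemeasurable

theorem measurable_fTet (P : Fin 4 → E3) (i : Fin 4) : Measurable (fTet P i) := by
  have : Continuous (f P i) := by unfold f; fun_prop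
  exact (this.measurable.comp measurable_subtype_coe).subtype_mk

theorem measurable_cons (i : Fin 4) : Measurable (cons i) := by
  refine measurable_pi_lambda _ fun n => ?_
  cases n with
  | zero => exact measurable_const
  | succ n => exact measurable_pi_apply n

theorem letterLaw_apply (A : Set (Fin 4)) [DecidablePred (· ∈ A)] :
    letterLaw A = ∑ i : Fin 4, (4⁻¹ : ENNReal) * if i ∈ A then 1 else 0 := by
  rw [letterLaw, PMF.toMeasure_apply_fintype]
  refine Finset.sum_congr rfl fun i _ => ?_
  by_cases h : i ∈ A <;> simp [h]

theorem infinitePi_letterLaw_eq :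
    (Measure.infinitePi fun _ : ℕ => letterLaw) =
      ∑ i : Fin 4, (4⁻¹ : ENNReal) • (Measure.infinitePi fun _ : ℕ => letterLaw).map (cons i) := by
  classical
  symm
  apply Measure.eq_infinitePi
  intro s t ht
  set s' : Finset ℕ := s.preimage Nat.succ (Nat.succ_injective.injOn) with hs'
  set t₀ : Set (Fin 4) := if 0 ∈ s then t 0 else Set.univ with ht₀
  have hpre : ∀ i, cons i ⁻¹' (Set.pi (s : Set ℕ) t) =
      if i ∈ t₀ then Set.pi (s' : Set ℕ) (fun n => t (n + 1)) else ∅ := by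
    intro i
    ext ω
    have key : cons i ω ∈ Set.pi (s : Set ℕ) t ↔
        i ∈ t₀ ∧ ω ∈ Set.pi (s' : Set ℕ) (fun n => t (n + 1)) := by
      constructor
      · intro h
        refine ⟨?_, fun n hn => h (n + 1) (by simpa [hs'] using hn)⟩
        by_cases h0 : 0 ∈ s
        · simpa [ht₀, h0, cons] using h 0 h0
        · simp [ht₀, h0]
      · rintro ⟨h0, h⟩ n hn
        cases n with
        | zero =>
          have h0s : 0 ∈ s := hn
          simpa [ht₀, h0s, cons] using h0
        | succ n => exact h n (by simpa [hs'] using hn)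
    rw [Set.mem_preimage, key]
    by_cases h : i ∈ t₀ <;> simp [h]
  have hprod : ∏ n ∈ s, letterLaw (t n) = letterLaw t₀ * ∏ n ∈ s', letterLaw (t (n + 1)) := by
    have himg : s.erase 0 = s'.image Nat.succ := by
      ext n
      cases n with
      | zero => simp
      | succ n => simp [hs']
    have h1 : ∏ n ∈ s.erase 0, letterLaw (t n) = ∏ n ∈ s', letterLaw (t (n + 1)) := by
      rw [himg, Finset.prod_image (fun a _ b _ h => Nat.succ_injective h)]
    rw [← h1]
    by_cases h0 : 0 ∈ s
    · rw [← Finset.mul_prod_erase s _ h0]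
      simp [ht₀, h0]
    · rw [Finset.erase_eq_of_notMem h0]
      simp [ht₀, h0]
  rw [hprod, letterLaw_apply, Finset.sum_mul, Measure.finsetSum_apply]
  refine Finset.sum_congr rfl fun i _ => ?_
  rw [Measure.smul_apply, Measure.map_apply (measurable_cons i)
    (MeasurableSet.pi (Finset.countable_toSet s) fun n _ => ht n), hpre, smul_eq_mul, mul_assoc]
  congr 1
  by_cases h : i ∈ t₀
  · simp only [h, if_true, one_mul]
    exact Measure.infinitePi_pi _ fun n _ => ht (n + 1)
  · simp [h]

theorem mu_selfSimilar (P : Fin 4 → E3) :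
    mu P = ∑ i : Fin 4, (4⁻¹ : ENNReal) • (mu P).map (fTet P i) := by
  conv_lhs => rw [mu, infinitePi_letterLaw_eq]
  rw [← Measure.mapₗ_apply_of_measurable (measurable_codeTet P), map_sum]
  refine Finset.sum_congr rfl fun i _ => ?_
  rw [map_smul, Measure.mapₗ_apply_of_measurable (measurable_codeTet P),
    Measure.map_map (measurable_codeTet P) (measurable_cons i), mu,
    Measure.map_map (measurable_fTet P i) (measurable_codeTet P)]
  congr 2
  funext ω
  exact Subtype.ext (code_cons P i ω)

/-- `g` is a Laplacian `Δu` of `u`: `𝓔(u,v) = -∫ v g dμ` for all `v ∈ dom₀ 𝓔`. -/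
def IsLaplacian (P : Fin 4 → E3) (u g : C(Tet P, ℝ)) : Prop :=
  ∀ v ∈ domE₀ P, energy P u v = -∫ X, v X * g X ∂(mu P)

/-- `dom Δ`: the functions of `dom 𝓔` that have a continuous Laplacian. -/
def domLaplacian (P : Fin 4 → E3) : Set C(Tet P, ℝ) :=
  {u | u ∈ domE P ∧ ∃ g : C(Tet P, ℝ), IsLaplacian P u g}

open Classical in
/-- The renormalized graph difference `r^{-m} ∑_{Y ∈ V_m, Y ∼_m X} (u(X) - u(Y))`. -/
def normalDiff (P : Fin 4 → E3) (u : C(Tet P, ℝ)) (X : Tet P) (m : ℕ) : ℝ :=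
  r⁻¹ ^ m * ∑ Y ∈ V P m with (graph P m).Adj Y X, (u X - u Y)

/-- `u` admits a normal derivative at `X`: the renormalized differences have a finite limit. -/
def HasNormalDeriv (P : Fin 4 → E3) (u : C(Tet P, ℝ)) (X : Tet P) : Prop :=
  ∃ d : ℝ, Tendsto (normalDiff P u X) atTop (𝓝 d)

/-- The normal derivative `∂ₙu(X)` (meaningful where the limit exists). -/
def normalDeriv (P : Fin 4 → E3) (u : C(Tet P, ℝ)) (X : Tet P) : ℝ :=
  limUnder atTop (normalDiff P u X)

end

end SierpinskiTetrahedron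

open SierpinskiTetrahedron

namespace SierpinskiTetrahedron

/-! ### Barycentric coordinates -/

variable {P : Fin 4 → E3}

/-! The normal difference of `u` at `X` on level `m` is the discrete energy of `u` against the
indicator of `X` on `V_m` (`energyLevel_eq_normalDiff`). Extending this indicator harmonically into
every cell of level `m` gives a tent function `ψ_m` (`exists_tent`). Harmonic extension takes a mean
with weights 2/6, 2/6, 1/6, 1/6 at each new vertex; it is energy-orthogonal to functions vanishing
at the corners (`cellEnergy_harmonicStep`), and `r = 2/3` is the factor that makes the energy
survive refinement unchanged. Hence `𝓔_k(u, ψ_m)` is constant for `k ≥ m`, and the normal difference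
equals the full energy `𝓔(u, ψ_m)`.

The weak equation for the Laplacian now applies. If `X ∉ V_0`, the tent vanishes on `V_0`, and the
normal difference is `-∫ ψ_m Δu dμ`, which tends to 0 because the tents have vanishing mass. If `X ∈
V_0`, the tent is first corrected by a fixed function `φ` with the same boundary values; the limit
is `𝓔(u, φ) + ∫ φ Δu dμ`. Testing the weak equation with `v` minus the harmonic function sharing its
boundary values then turns these limits into the Gauss–Green formula. -/

theorem continuous_fTet (P : Fin 4 → E3) (i : Fin 4) : Continuous (fTet P i) := by
  have : Continuous (f P i) := by unfold f; fun_prop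
  exact (this.comp continuous_subtype_val).subtype_mk _

/-- The contraction `f_i` as a continuous self-map of the Sierpiński tetrahedron. -/
noncomputable def cellMap (P : Fin 4 → E3) (i : Fin 4) : C(Tet P, Tet P) := ⟨fTet P i, continuous_fTet P i⟩

@[simp] theorem cellMap_apply (i : Fin 4) (X : Tet P) : cellMap P i X = fTet P i X := rfl

instance : CompactSpace (Tet P) := isCompact_iff_compactSpace.1 (isCompact_carrier P)

instance : Nonempty (Tet P) := ⟨corner P 0⟩

theorem fTet_injective (P : Fin 4 → E3) (i : Fin 4) : Function.Injective (fTet P i) := by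
  intro X Y h
  have h1 : f P i X = f P i Y := congrArg Subtype.val h
  have h2 := dist_f P i X Y
  rw [h1, dist_self] at h2
  exact Subtype.ext (dist_eq_zero.1 (by linarith))

@[simp] theorem fTet_corner_self (P : Fin 4 → E3) (i : Fin 4) :
    fTet P i (corner P i) = corner P i := by
  apply Subtype.ext
  simp only [fTet, corner, f]
  module

theorem fTet_corner_comm (P : Fin 4 → E3) (i j : Fin 4) :
    fTet P i (corner P j) = fTet P j (corner P i) := by
  apply Subtype.ext
  simp only [fTet, corner, f, add_comm]

theorem exists_fTet_eq (X : Tet P) : ∃ i Y, fTet P i Y = X := by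
  have hX := (carrier_selfSimilar P).subset X.2
  obtain ⟨i, Y, hY, h⟩ := Set.mem_iUnion.1 hX
  exact ⟨i, ⟨Y, hY⟩, Subtype.ext h⟩

theorem corner_injective (hP : AffineIndependent ℝ P) : Function.Injective (corner P) :=
  fun _ _ h => hP.injective (congrArg Subtype.val h)

/-- A continuous function that is halved, up to a non-negative summand, by each `f_i` is
non-negative: it attains a minimum `m`, and `m ≥ m / 2`. -/
theorem nonneg_of_half_le (l : C(Tet P, ℝ)) (h : ∀ i X, l X / 2 ≤ l (fTet P i X)) (X : Tet P) :
    0 ≤ l X := by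
  obtain ⟨Z, -, hZ⟩ := isCompact_univ.exists_isMinOn Set.univ_nonempty l.continuous.continuousOn
  have hmin : ∀ Y, l Z ≤ l Y := fun Y => hZ (Set.mem_univ Y)
  obtain ⟨i, Y, rfl⟩ := exists_fTet_eq Z
  linarith [hmin X, hmin Y, h i Y]

/-- Each contraction halves the coordinates and adds a non-negative shift, so the minimum argument
above makes them non-negative on the tetrahedron. They separate points and serve to locate the
intersections of cells. -/
theorem exists_barycentric (hP : AffineIndependent ℝ P) :
    ∃ l : Fin 4 → C(Tet P, ℝ), (∀ i X, 0 ≤ l i X) ∧ (∀ X, ∑ i, l i X = 1) ∧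
      (∀ i j, l i (corner P j) = if i = j then 1 else 0) ∧
      (∀ i j X, l i (fTet P j X) = (l i X + if i = j then 1 else 0) / 2) ∧
      ∀ X Y, (∀ i, l i X = l i Y) → X = Y := by
  have htop : affineSpan ℝ (Set.range P) = ⊤ := by
    rw [hP.affineSpan_eq_top_iff_card_eq_finrank_add_one]
    simp
  let b : AffineBasis (Fin 4) ℝ E3 := ⟨P, hP, htop⟩
  have hbP : ∀ i, b i = P i := fun _ => rfl
  let l : Fin 4 → C(Tet P, ℝ) := fun i =>
    ⟨fun X => b.coord i X, (continuous_barycentric_coord b i).comp continuous_subtype_val⟩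
  have hl : ∀ i X, l i X = b.coord i X := fun _ _ => rfl
  have hcorner : ∀ i j, b.coord i (P j) = if i = j then 1 else 0 := fun i j => by
    rw [← hbP j, b.coord_apply]
  have hstep : ∀ i j X, l i (fTet P j X) = (l i X + if i = j then 1 else 0) / 2 := by
    intro i j X
    have : (f P j X : E3) = AffineMap.lineMap (X : E3) (P j) (1 / 2 : ℝ) := by
      rw [AffineMap.lineMap_apply_module, f]
      module
    rw [hl, hl]
    change b.coord i (f P j X) = _
    rw [this, AffineMap.apply_lineMap, hcorner, AffineMap.lineMap_apply_module]
    simp only [smul_eq_mul]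
    ring
  refine ⟨l, fun i => nonneg_of_half_le (l i) fun j X => ?_, fun X => b.sum_coord_apply_eq_one _,
    fun i j => hcorner i j, hstep, fun X Y h => Subtype.ext (b.ext_elem h)⟩
  rw [hstep]
  split_ifs <;> linarith

/-- Two different cells of level one meet at most in their common vertex. -/
theorem eq_corner_of_fTet_eq (hP : AffineIndependent ℝ P) {i j : Fin 4} (hij : i ≠ j)
    {X Y : Tet P} (h : fTet P i X = fTet P j Y) : X = corner P j := by
  obtain ⟨l, h0, h1, hc, hs, hext⟩ := exists_barycentric hP
  -- On the common point the `j`-th coordinate is `l j X / 2`, seen from cell `i`, and `(l j Y + 1)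
  -- / 2`, seen from cell `j`.
  have hj : 1 ≤ l j X := by
    have := congrArg (l j) h
    rw [hs, hs, if_neg hij.symm, if_pos rfl] at this
    linarith [h0 j Y]
  apply hext
  intro k
  have hsum := h1 X
  rw [← Finset.add_sum_erase _ _ (Finset.mem_univ j)] at hsum
  have hnn : 0 ≤ ∑ x ∈ Finset.univ.erase j, l x X := Finset.sum_nonneg fun x _ => h0 x X
  rw [hc]
  split_ifs with hk
  · subst hk; linarith
  · have := Finset.single_le_sum (f := fun x => l x X) (fun x _ => h0 x X)
      (Finset.mem_erase.2 ⟨hk, Finset.mem_univ k⟩)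
    linarith [h0 k X]

/-! ### Gluing and harmonic functions -/

/-- By compactness the tetrahedron is a topological quotient of four disjoint copies of itself, and
the only identifications between different copies are at the shared vertices, where `hg` gives
agreement. -/
theorem exists_glue (hP : AffineIndependent ℝ P) (g : Fin 4 → C(Tet P, ℝ))
    (hg : ∀ i j, g i (corner P j) = g j (corner P i)) :
    ∃ G : C(Tet P, ℝ), ∀ i X, G (fTet P i X) = g i X := by
  let q : C(Fin 4 × Tet P, Tet P) :=
    ⟨fun p => fTet P p.1 p.2, continuous_prod_of_discrete_left.2 fun i => continuous_fTet P i⟩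
  have hq : IsQuotientMap q := by
    refine q.continuous.isClosedMap.isQuotientMap q.continuous fun X => ?_
    obtain ⟨i, Y, h⟩ := exists_fTet_eq X
    exact ⟨(i, Y), h⟩
  let G : C(Fin 4 × Tet P, ℝ) :=
    ⟨fun p => g p.1 p.2, continuous_prod_of_discrete_left.2 fun i => (g i).continuous⟩
  have hG : Function.FactorsThrough G q := by
    rintro ⟨i, X⟩ ⟨j, Y⟩ h
    change g i X = g j Y
    by_cases hij : i = j
    · subst hij
      exact congrArg (g i) (fTet_injective P i h)
    · have hX : X = corner P j := eq_corner_of_fTet_eq hP hij h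
      have hY : Y = corner P i := eq_corner_of_fTet_eq hP (Ne.symm hij) h.symm
      rw [hX, hY, hg]
  exact ⟨hq.lift G hG, fun i X => congrArg (fun F => F (i, X)) (hq.lift_comp G hG)⟩

/-- The boundary values on the cell `f_i(V_0)` of the harmonic function with boundary values `a`. -/
noncomputable def harmonicStep (a : Fin 4 → ℝ) (i j : Fin 4) : ℝ :=
  if i = j then a i else (a i + a j + ∑ k, a k) / 6

theorem harmonicStep_comm (a : Fin 4 → ℝ) (i j : Fin 4) :
    harmonicStep a i j = harmonicStep a j i := by
  unfold harmonicStep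
  by_cases h : i = j
  · rw [h]
  · rw [if_neg h, if_neg (Ne.symm h), add_comm (a i)]

@[simp] theorem harmonicStep_self (a : Fin 4 → ℝ) (i : Fin 4) : harmonicStep a i i = a i :=
  if_pos rfl

/-- Every value on cell `i` is one third of `a i` plus two thirds of a convex combination of the `a
k`. So the oscillation shrinks by 2/3, the contraction rate behind the existence of harmonic
functions. -/
theorem harmonicStep_mem {a : Fin 4 → ℝ} {c d : ℝ} (h : ∀ j, a j ∈ Set.Icc c d) (i j : Fin 4) :
    harmonicStep a i j ∈ Set.Icc (a i / 3 + 2 / 3 * c) (a i / 3 + 2 / 3 * d) := by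
  have h0 := h 0
  have h1 := h 1
  have h2 := h 2
  have h3 := h 3
  simp only [Set.mem_Icc] at *
  unfold harmonicStep
  fin_cases i <;> fin_cases j <;> simp [Fin.sum_univ_four] <;> constructor <;> linarith

theorem harmonicStep_mem' {a : Fin 4 → ℝ} {c d : ℝ} (h : ∀ j, a j ∈ Set.Icc c d) (i j : Fin 4) :
    harmonicStep a i j ∈ Set.Icc c d := by
  have h1 := harmonicStep_mem h i j
  have h2 := h i
  simp only [Set.mem_Icc] at *
  constructor <;> linarith

/-- The harmonic functions are the limit of iterating the refinement operator `T`, starting from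
affine interpolation. Successive iterates differ by at most the oscillation of the data times
`(2/3)^n`, so they converge uniformly. -/
theorem exists_harmonic (hP : AffineIndependent ℝ P) :
    ∃ h : (Fin 4 → ℝ) → C(Tet P, ℝ), (∀ a i, h a (corner P i) = a i) ∧
      (∀ a i X, h a (fTet P i X) = h (harmonicStep a i) X) ∧
      ∀ a c d, (∀ i, a i ∈ Set.Icc c d) → ∀ X, h a X ∈ Set.Icc c d := by
  -- Prescribed corner values are part of the type, since the four pieces glue only if they match at
  -- shared vertices.
  let F := {G : (Fin 4 → ℝ) → C(Tet P, ℝ) // ∀ a i, G a (corner P i) = a i}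
  have hT : ∀ G : F, ∃ G' : F, ∀ a i X, G'.1 a (fTet P i X) = G.1 (harmonicStep a i) X := by
    intro G
    have hg : ∀ a : Fin 4 → ℝ, ∃ G' : C(Tet P, ℝ),
        ∀ i X, G' (fTet P i X) = G.1 (harmonicStep a i) X := fun a =>
      exists_glue hP (fun i => G.1 (harmonicStep a i)) fun i j => by
        rw [G.2, G.2, harmonicStep_comm]
    choose G' hG' using hg
    refine ⟨⟨G', fun a i => ?_⟩, hG'⟩
    rw [← fTet_corner_self, hG', G.2, harmonicStep_self]
  choose T hT using hT
  obtain ⟨l, h0, h1, hc, -, -⟩ := exists_barycentric hP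
  let G₀ : F := ⟨fun a => ∑ i, a i • l i, fun a i => by
    simp [ContinuousMap.sum_apply, hc]⟩
  let s : ℕ → F := fun n => T^[n] G₀
  have hs : ∀ n a i X, (s (n + 1)).1 a (fTet P i X) = (s n).1 (harmonicStep a i) X := by
    intro n a i X
    change (T^[n + 1] G₀).1 a _ = _
    rw [Function.iterate_succ_apply', hT]
  have hrange : ∀ n a c d, (∀ i, a i ∈ Set.Icc c d) → ∀ X, (s n).1 a X ∈ Set.Icc c d := by
    intro n
    induction n with
    | zero =>
      intro a c d ha X
      have : (s 0).1 a X = ∑ i, l i X * a i := by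
        change (∑ i, a i • l i : C(Tet P, ℝ)) X = _
        simp [ContinuousMap.sum_apply, mul_comm]
      rw [this]
      exact (convex_Icc c d).sum_mem (fun i _ => h0 i X) (h1 X) fun i _ => ha i
    | succ n ih =>
      intro a c d ha X
      obtain ⟨i, Y, rfl⟩ := exists_fTet_eq X
      rw [hs]
      exact ih _ c d (harmonicStep_mem' ha i) Y
  have hdiff : ∀ n a c d, (∀ i, a i ∈ Set.Icc c d) → ∀ X,
      |(s n).1 a X - (s (n + 1)).1 a X| ≤ (d - c) * (2 / 3) ^ n := by
    intro n
    induction n with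
    | zero =>
      intro a c d ha X
      have hx := hrange 0 a c d ha X
      have hy := hrange 1 a c d ha X
      simp only [Set.mem_Icc] at hx hy
      rw [pow_zero, mul_one, abs_le, zero_add]
      constructor <;> linarith
    | succ n ih =>
      intro a c d ha X
      obtain ⟨i, Y, rfl⟩ := exists_fTet_eq X
      rw [hs, hs]
      refine (ih _ _ _ (harmonicStep_mem ha i) Y).trans_eq ?_
      ring
  have hbd : ∀ a : Fin 4 → ℝ, ∀ i, a i ∈ Set.Icc (-∑ j, |a j|) (∑ j, |a j|) := fun a i =>
    abs_le.1 (Finset.single_le_sum (f := fun j => |a j|) (fun j _ => abs_nonneg _)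
      (Finset.mem_univ i))
  have hlim : ∀ a, ∃ g : C(Tet P, ℝ), Tendsto (fun n => (s n).1 a) atTop (𝓝 g) := by
    intro a
    refine cauchySeq_tendsto_of_complete (cauchySeq_of_le_geometric (2 / 3)
      ((∑ j, |a j|) - -∑ j, |a j|) (by norm_num) fun n => ?_)
    rw [ContinuousMap.dist_le_iff_of_nonempty]
    exact fun X => hdiff n a _ _ (hbd a) X
  choose h hh using hlim
  have hpt : ∀ a X, Tendsto (fun n => (s n).1 a X) atTop (𝓝 (h a X)) := fun a X =>
    ((continuous_eval_const X).tendsto (h a)).comp (hh a)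
  refine ⟨h, fun a i => ?_, fun a i X => ?_, fun a c d ha X => ?_⟩
  · refine tendsto_nhds_unique (hpt a _) ?_
    simp only [(s _).2, tendsto_const_nhds]
  · refine tendsto_nhds_unique ((hpt a _).comp (tendsto_add_atTop_nat 1)) ?_
    simpa only [Function.comp_def, hs] using hpt (harmonicStep a i) X
  · exact isClosed_Icc.mem_of_tendsto (hpt a X) (Eventually.of_forall fun n => hrange n a c d ha X)

/-! ### Energies of finite level -/

theorem corner_mem_V (P : Fin 4 → E3) (i : Fin 4) (m : ℕ) : corner P i ∈ V P m := by
  classical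
  induction m with
  | zero => exact Finset.mem_image_of_mem _ (Finset.mem_univ i)
  | succ m ih =>
    exact Finset.mem_biUnion.2 ⟨i, Finset.mem_univ i,
      Finset.mem_image.2 ⟨_, ih, fTet_corner_self P i⟩⟩

theorem mem_V_succ {m : ℕ} {X : Tet P} : X ∈ V P (m + 1) ↔ ∃ i, ∃ Y ∈ V P m, fTet P i Y = X := by
  classical
  simp [V]

theorem mem_V_zero {X : Tet P} : X ∈ V P 0 ↔ ∃ i, corner P i = X := by
  classical
  simp [V]

theorem V_subset_succ (P : Fin 4 → E3) (m : ℕ) : V P m ⊆ V P (m + 1) := by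
  induction m with
  | zero =>
    intro X hX
    obtain ⟨i, rfl⟩ := mem_V_zero.1 hX
    exact corner_mem_V P i 1
  | succ m ih =>
    intro X hX
    obtain ⟨i, Y, hY, rfl⟩ := mem_V_succ.1 hX
    exact mem_V_succ.2 ⟨i, Y, ih hY, rfl⟩

theorem V_mono (P : Fin 4 → E3) : Monotone (V P) := monotone_nat_of_le_succ (V_subset_succ P)

theorem wordMap_corner_mem_V (P : Fin 4 → E3) (W : List (Fin 4)) (i : Fin 4) :
    wordMap P W (corner P i) ∈ V P W.length := by
  induction W with
  | nil => exact corner_mem_V P i 0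
  | cons j W ih => exact mem_V_succ.2 ⟨j, _, ih, rfl⟩

theorem mem_V_of_adj {m : ℕ} {X Y : Tet P} (h : (graph P m).Adj X Y) : X ∈ V P m := by
  obtain ⟨-, W, rfl, i, j, rfl, -⟩ := h
  exact wordMap_corner_mem_V P W i

theorem adj_zero (hP : AffineIndependent ℝ P) {X Y : Tet P} :
    (graph P 0).Adj X Y ↔ ∃ i j, i ≠ j ∧ corner P i = X ∧ corner P j = Y := by
  constructor
  · rintro ⟨h, W, hW, i, j, rfl, rfl⟩
    rw [List.length_eq_zero_iff] at hW
    subst hW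
    exact ⟨i, j, fun hij => h (by rw [hij]), rfl, rfl⟩
  · rintro ⟨i, j, h, rfl, rfl⟩
    exact ⟨(corner_injective hP).ne h, [], rfl, i, j, rfl, rfl⟩

theorem adj_succ {m : ℕ} {X Y : Tet P} :
    (graph P (m + 1)).Adj X Y ↔
      ∃ i X' Y', (graph P m).Adj X' Y' ∧ fTet P i X' = X ∧ fTet P i Y' = Y := by
  constructor
  · rintro ⟨h, W, hW, i, j, rfl, rfl⟩
    obtain ⟨k, W, rfl⟩ := List.exists_cons_of_length_eq_add_one hW
    refine ⟨k, _, _, ⟨fun h' => h ?_, W, by simpa using hW, i, j, rfl, rfl⟩, rfl, rfl⟩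
    exact congrArg (fTet P k) h'
  · rintro ⟨i, _, _, ⟨h, W, hW, j, k, rfl, rfl⟩, rfl, rfl⟩
    exact ⟨(fTet_injective P i).ne h, i :: W, by simp [hW], j, k, rfl, rfl⟩

open Classical in
/-- The directed edges of the graph of level `m`. -/
noncomputable def darts (P : Fin 4 → E3) (m : ℕ) : Finset (Tet P × Tet P) :=
  (V P m ×ˢ V P m).filter fun p => (graph P m).Adj p.1 p.2

theorem mem_darts {m : ℕ} {p : Tet P × Tet P} : p ∈ darts P m ↔ (graph P m).Adj p.1 p.2 := by
  simp only [darts, Finset.mem_filter, Finset.mem_product, and_iff_right_iff_imp]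
  exact fun h => ⟨mem_V_of_adj h, mem_V_of_adj h.symm⟩

theorem energyLevel_eq (P : Fin 4 → E3) (m : ℕ) (u v : C(Tet P, ℝ)) :
    energyLevel P m u v =
      (3 / 2) ^ m * (1 / 2 * ∑ p ∈ darts P m, (u p.1 - u p.2) * (v p.1 - v p.2)) := by
  classical
  simp only [energyLevel, r, darts, Finset.sum_filter, Finset.sum_product]
  norm_num

/-- The energy on a single cell. -/
noncomputable def cellEnergy (a b : Fin 4 → ℝ) : ℝ :=
  1 / 2 * ∑ i, ∑ j, (a i - a j) * (b i - b j)

theorem energyLevel_zero (hP : AffineIndependent ℝ P) (u v : C(Tet P, ℝ)) :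
    energyLevel P 0 u v = cellEnergy (fun i => u (corner P i)) fun i => v (corner P i) := by
  classical
  have h : darts P 0 = (Finset.univ.filter fun p : Fin 4 × Fin 4 => p.1 ≠ p.2).image
      (Prod.map (corner P) (corner P)) := by
    ext ⟨X, Y⟩
    rw [mem_darts, adj_zero hP]
    simp
  rw [energyLevel_eq, h, Finset.sum_image
    ((corner_injective hP).prodMap (corner_injective hP)).injOn, Finset.sum_filter_of_ne,
    ← Finset.univ_product_univ, Finset.sum_product, pow_zero, one_mul]
  · rfl
  · rintro ⟨i, j⟩ - h1 (h2 : i = j)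
    simp [h2] at h1

/-- Distinct cells share at most one point, hence no edge, so the edges split disjointly among the
four cells. -/
theorem energyLevel_succ (hP : AffineIndependent ℝ P) (m : ℕ) (u v : C(Tet P, ℝ)) :
    energyLevel P (m + 1) u v =
      3 / 2 * ∑ i, energyLevel P m (u.comp (cellMap P i)) (v.comp (cellMap P i)) := by
  classical
  have h : darts P (m + 1) = Finset.univ.biUnion fun i =>
      (darts P m).image (Prod.map (fTet P i) (fTet P i)) := by
    ext ⟨X, Y⟩
    rw [mem_darts, adj_succ]
    simp [mem_darts]
  have hdisj : ((Finset.univ : Finset (Fin 4)) : Set (Fin 4)).PairwiseDisjoint fun i =>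
      (darts P m).image (Prod.map (fTet P i) (fTet P i)) := by
    intro i _ j _ hij
    refine Finset.disjoint_left.2 fun p hp hq => ?_
    obtain ⟨⟨X, Y⟩, hXY, rfl⟩ := Finset.mem_image.1 hp
    obtain ⟨⟨X', Y'⟩, -, h'⟩ := Finset.mem_image.1 hq
    simp only [Prod.map_apply, Prod.mk.injEq] at h'
    refine (mem_darts.1 hXY).1 ?_
    change X = Y
    rw [eq_corner_of_fTet_eq hP hij h'.1.symm, eq_corner_of_fTet_eq hP hij h'.2.symm]
  rw [energyLevel_eq, h, Finset.sum_biUnion hdisj]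
  simp_rw [energyLevel_eq, ← Finset.mul_sum]
  rw [pow_succ']
  simp_rw [Finset.sum_image ((fTet_injective P _).prodMap (fTet_injective P _)).injOn]
  simp only [Prod.map_fst, Prod.map_snd, ContinuousMap.comp_apply, cellMap_apply]
  ring

/-- Discrete Green identity on one cell: harmonic extension is energy-orthogonal to functions
vanishing at the corners. -/
theorem cellEnergy_harmonicStep (a : Fin 4 → ℝ) (w : Fin 4 → Fin 4 → ℝ)
    (hw : ∀ i j, w i j = w j i) :
    3 / 2 * ∑ i, cellEnergy (w i) (harmonicStep a i) = cellEnergy (fun i => w i i) a := by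
  simp only [cellEnergy, harmonicStep, Fin.sum_univ_four]
  simp [hw 1 0, hw 2 0, hw 3 0, hw 2 1, hw 3 1, hw 3 2]
  ring

theorem cellEnergy_self_nonneg (a : Fin 4 → ℝ) : 0 ≤ cellEnergy a a :=
  mul_nonneg (by norm_num) (Finset.sum_nonneg fun _ _ => Finset.sum_nonneg fun _ _ =>
    mul_self_nonneg _)

theorem cellEnergy_sub_sub (a b : Fin 4 → ℝ) :
    cellEnergy (a - b) (a - b) = cellEnergy a a - 2 * cellEnergy a b + cellEnergy b b := by
  simp only [cellEnergy, Fin.sum_univ_four, Pi.sub_apply]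
  ring

/-- Pythagoras: by the Green identity, the cross term of `w` with the harmonic extension and the
energy of that extension both equal the coarse energy. The excess is thus the energy of the
difference. -/
theorem cellEnergy_le (w : Fin 4 → Fin 4 → ℝ) (hw : ∀ i j, w i j = w j i) :
    cellEnergy (fun i => w i i) (fun i => w i i) ≤ 3 / 2 * ∑ i, cellEnergy (w i) (w i) := by
  set a : Fin 4 → ℝ := fun i => w i i with ha
  have h1 := cellEnergy_harmonicStep a w hw
  have h2 := cellEnergy_harmonicStep a (harmonicStep a) (harmonicStep_comm a)
  simp only [harmonicStep_self] at h2
  have h3 : 0 ≤ ∑ i, cellEnergy (w i - harmonicStep a i) (w i - harmonicStep a i) :=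
    Finset.sum_nonneg fun i _ => cellEnergy_self_nonneg _
  simp only [cellEnergy_sub_sub, Finset.sum_add_distrib, Finset.sum_sub_distrib,
    ← Finset.mul_sum] at h3
  change _ = cellEnergy a a at h1
  change _ = cellEnergy a a at h2
  linarith

theorem energyLevel_le_succ (hP : AffineIndependent ℝ P) (m : ℕ) (u : C(Tet P, ℝ)) :
    energyLevel P m u u ≤ energyLevel P (m + 1) u u := by
  induction m generalizing u with
  | zero =>
    rw [energyLevel_succ hP]
    simp only [energyLevel_zero hP]
    have h := cellEnergy_le (fun i j => u (fTet P i (corner P j))) fun i j => by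
      rw [fTet_corner_comm]
    simpa using h
  | succ m ih =>
    rw [energyLevel_succ hP m, energyLevel_succ hP (m + 1)]
    gcongr with i
    exact ih _

theorem energyLevel_mono (hP : AffineIndependent ℝ P) (u : C(Tet P, ℝ)) :
    Monotone fun m => energyLevel P m u u :=
  monotone_nat_of_le_succ fun m => energyLevel_le_succ hP m u

theorem energyLevel_add_left (m : ℕ) (u v w : C(Tet P, ℝ)) :
    energyLevel P m (u + v) w = energyLevel P m u w + energyLevel P m v w := by
  simp only [energyLevel_eq, ContinuousMap.add_apply, ← mul_add, ← Finset.sum_add_distrib]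
  congr 2
  exact Finset.sum_congr rfl fun p _ => by ring

theorem energyLevel_smul_left (m : ℕ) (c : ℝ) (u v : C(Tet P, ℝ)) :
    energyLevel P m (c • u) v = c * energyLevel P m u v := by
  simp only [energyLevel_eq, ContinuousMap.smul_apply, smul_eq_mul, Finset.mul_sum]
  exact Finset.sum_congr rfl fun p _ => by ring

theorem energyLevel_comm (m : ℕ) (u v : C(Tet P, ℝ)) :
    energyLevel P m u v = energyLevel P m v u := by
  simp only [energyLevel_eq, mul_comm (u _ - u _)]

theorem energyLevel_add_right (m : ℕ) (u v w : C(Tet P, ℝ)) :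
    energyLevel P m u (v + w) = energyLevel P m u v + energyLevel P m u w := by
  rw [energyLevel_comm, energyLevel_add_left, energyLevel_comm m v, energyLevel_comm m w]

theorem energyLevel_smul_right (m : ℕ) (c : ℝ) (u v : C(Tet P, ℝ)) :
    energyLevel P m u (c • v) = c * energyLevel P m u v := by
  rw [energyLevel_comm, energyLevel_smul_left, energyLevel_comm]

theorem energyLevel_self_nonneg (m : ℕ) (u : C(Tet P, ℝ)) : 0 ≤ energyLevel P m u u := by
  rw [energyLevel_eq]
  have : 0 ≤ ∑ p ∈ darts P m, (u p.1 - u p.2) * (u p.1 - u p.2) :=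
    Finset.sum_nonneg fun _ _ => mul_self_nonneg _
  positivity

theorem energyLevel_zero_right (m : ℕ) (u : C(Tet P, ℝ)) : energyLevel P m u 0 = 0 := by
  simp [energyLevel_eq]

open Classical in
/-- The renormalized difference at `X` is the energy against the indicator function of `X`. -/
theorem energyLevel_eq_normalDiff {m : ℕ} {X : Tet P} (u : C(Tet P, ℝ)) {ψ : C(Tet P, ℝ)}
    (hψ : ∀ Y ∈ V P m, ψ Y = if Y = X then 1 else 0) :
    energyLevel P m u ψ = normalDiff P u X m := by
  have key : ∀ g : Tet P × Tet P → ℝ,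
      ∑ p ∈ darts P m, g p * (if p.2 = X then 1 else 0) =
        ∑ Y ∈ V P m with (graph P m).Adj Y X, g (Y, X) := by
    intro g
    simp only [mul_ite, mul_one, mul_zero]
    rw [← Finset.sum_filter]
    refine Finset.sum_nbij' Prod.fst (fun Y => (Y, X)) ?_ ?_ ?_ ?_ ?_
    · rintro ⟨Y, Z⟩ h
      simp only [Finset.mem_filter, mem_darts] at h ⊢
      obtain ⟨h, rfl⟩ := h
      exact ⟨mem_V_of_adj h, h⟩
    · intro Y h
      simp only [Finset.mem_filter, mem_darts] at h ⊢
      exact ⟨h.2, trivial⟩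
    · rintro ⟨Y, Z⟩ h
      simp only [Finset.mem_filter] at h
      rw [← h.2]
    · intro Y _
      rfl
    · rintro ⟨Y, Z⟩ h
      simp only [Finset.mem_filter] at h
      rw [← h.2]
  -- Edges leaving and entering `X` contribute equally, which cancels the factor 1/2 of the energy.
  have hswap : ∑ p ∈ darts P m, (u p.1 - u p.2) * (if p.1 = X then 1 else 0) =
      ∑ p ∈ darts P m, (u p.2 - u p.1) * (if p.2 = X then 1 else 0) := by
    refine Finset.sum_nbij' Prod.swap Prod.swap ?_ ?_ ?_ ?_ ?_
    · intro p hp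
      exact mem_darts.2 (mem_darts.1 hp).symm
    · intro p hp
      exact mem_darts.2 (mem_darts.1 hp).symm
    · intro p _
      exact p.swap_swap
    · intro p _
      exact p.swap_swap
    · intro p _
      rfl
  have hsum : ∑ p ∈ darts P m, (u p.1 - u p.2) * (ψ p.1 - ψ p.2) =
      2 * ∑ Y ∈ V P m with (graph P m).Adj Y X, (u X - u Y) := by
    calc _ = ∑ p ∈ darts P m, (u p.1 - u p.2) * (if p.1 = X then 1 else 0) +
          ∑ p ∈ darts P m, (u p.2 - u p.1) * (if p.2 = X then 1 else 0) := by
          rw [← Finset.sum_add_distrib]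
          refine Finset.sum_congr rfl fun p hp => ?_
          rw [hψ _ (mem_V_of_adj (mem_darts.1 hp)), hψ _ (mem_V_of_adj (mem_darts.1 hp).symm)]
          ring
      _ = _ := by rw [hswap, ← two_mul, key fun p => u p.2 - u p.1]
  rw [energyLevel_eq, hsum, normalDiff, r, inv_div]
  ring

/-! ### Piecewise harmonic tent functions -/

theorem integrable_of_continuous (u : C(Tet P, ℝ)) : Integrable u (mu P) :=
  u.continuous.integrable_of_hasCompactSupport (HasCompactSupport.of_compactSpace _)

theorem integrable_mul (u v : C(Tet P, ℝ)) : Integrable (fun X => u X * v X) (mu P) :=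
  integrable_of_continuous (u * v)

theorem integral_selfSimilar (u : C(Tet P, ℝ)) :
    ∫ X, u X ∂(mu P) = 1 / 4 * ∑ i, ∫ X, u (fTet P i X) ∂(mu P) := by
  have hm : ∀ i, ∫ X, u X ∂((mu P).map (fTet P i)) = ∫ X, u (fTet P i X) ∂(mu P) := fun i =>
    integral_map (measurable_fTet P i).aemeasurable u.continuous.aestronglyMeasurable
  have hi : ∀ i, Integrable u ((mu P).map (fTet P i)) := fun i =>
    (integrable_map_measure u.continuous.aestronglyMeasurable
      (measurable_fTet P i).aemeasurable).2 (integrable_of_continuous (u.comp (cellMap P i)))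
  conv_lhs => rw [mu_selfSimilar]
  rw [integral_finsetSum_measure fun i _ => (hi i).smul_measure (by simp), Finset.mul_sum]
  refine Finset.sum_congr rfl fun i _ => ?_
  rw [integral_smul_measure, hm]
  norm_num

/-- The iterated Green identity: against a harmonic function, the energy sees only the corner values
of `u`, whatever the level. -/
theorem energyLevel_harmonic (hP : AffineIndependent ℝ P) {h : (Fin 4 → ℝ) → C(Tet P, ℝ)}
    (hc : ∀ a i, h a (corner P i) = a i)
    (hs : ∀ a i X, h a (fTet P i X) = h (harmonicStep a i) X) (a : Fin 4 → ℝ) (k : ℕ)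
    (u : C(Tet P, ℝ)) :
    energyLevel P k u (h a) = cellEnergy (fun i => u (corner P i)) a := by
  induction k generalizing a u with
  | zero => simp only [energyLevel_zero hP, hc]
  | succ k ih =>
    have hcomp : ∀ i, (h a).comp (cellMap P i) = h (harmonicStep a i) := fun i =>
      ContinuousMap.ext fun X => hs a i X
    rw [energyLevel_succ hP]
    simp only [hcomp, ih, ContinuousMap.comp_apply, cellMap_apply]
    rw [cellEnergy_harmonicStep a (fun i j => u (fTet P i (corner P j))) fun i j => by
      rw [fTet_corner_comm]]
    simp

/-- No point lies in three cells of level one. -/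
theorem exists_notMem_range_fTet (hP : AffineIndependent ℝ P) (X : Tet P) :
    ∃ i, X ∉ Set.range (fTet P i) := by
  by_contra! h
  obtain ⟨A, hA⟩ := h 0
  obtain ⟨B, hB⟩ := h 1
  obtain ⟨C, hC⟩ := h 2
  have h1 := eq_corner_of_fTet_eq hP (by decide : (0 : Fin 4) ≠ 1) (hA.trans hB.symm)
  have h2 := eq_corner_of_fTet_eq hP (by decide : (0 : Fin 4) ≠ 2) (hA.trans hC.symm)
  exact absurd (corner_injective hP (h1.symm.trans h2)) (by decide)

open Classical in
/-- The tent function of level `m` at `X`: the piecewise harmonic function of level `m` whose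
restriction to `V_m` is the indicator function of `X`. -/
theorem exists_tent (hP : AffineIndependent ℝ P) (m : ℕ) (X : Tet P) :
    ∃ ψ : C(Tet P, ℝ), (∀ Y ∈ V P m, ψ Y = if Y = X then 1 else 0) ∧
      (∀ Y, ψ Y ∈ Set.Icc 0 1) ∧
      (∀ u k, m ≤ k → energyLevel P k u ψ = energyLevel P m u ψ) ∧
      ∫ Y, ψ Y ∂(mu P) ≤ (3 / 4) ^ m := by
  induction m generalizing X with
  | zero =>
    obtain ⟨h, hc, hs, hr⟩ := exists_harmonic hP
    set a : Fin 4 → ℝ := fun i => if corner P i = X then 1 else 0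
    have ha : ∀ Y, h a Y ∈ Set.Icc 0 1 := hr a 0 1 fun i => by
      simp only [a]
      split_ifs <;> simp
    refine ⟨h a, fun Y hY => ?_, ha, fun u k _ => ?_, ?_⟩
    · obtain ⟨i, rfl⟩ := mem_V_zero.1 hY
      exact hc a i
    · simp only [energyLevel_harmonic hP hc hs]
    · calc ∫ Y, h a Y ∂(mu P) ≤ ∫ _, (1 : ℝ) ∂(mu P) :=
            integral_mono (integrable_of_continuous _) (integrable_const _) fun Y => (ha Y).2
        _ = (3 / 4) ^ 0 := by simp
  | succ m ih =>
    -- On a cell containing `X` the piece is the tent at the preimage of `X`; on any other cell it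
    -- is zero, which the last clause records for the mass estimate.
    have hg : ∀ i, ∃ g : C(Tet P, ℝ), (∀ Y ∈ V P m, g Y = if fTet P i Y = X then 1 else 0) ∧
        (∀ Y, g Y ∈ Set.Icc 0 1) ∧
        (∀ u k, m ≤ k → energyLevel P k u g = energyLevel P m u g) ∧
        ∫ Y, g Y ∂(mu P) ≤ (3 / 4) ^ m ∧ (X ∉ Set.range (fTet P i) → g = 0) := by
      intro i
      by_cases hX : X ∈ Set.range (fTet P i)
      · obtain ⟨X', rfl⟩ := hX
        obtain ⟨g, h1, h2, h3, h4⟩ := ih X'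
        refine ⟨g, fun Y hY => ?_, h2, h3, h4, fun h => absurd ⟨X', rfl⟩ h⟩
        simp only [h1 Y hY, (fTet_injective P i).eq_iff]
      · refine ⟨0, fun Y _ => ?_, by simp, by simp [energyLevel_zero_right], ?_, fun _ => rfl⟩
        · rw [if_neg fun h => hX ⟨Y, h⟩]
          rfl
        · simp only [ContinuousMap.zero_apply, integral_zero]
          positivity
    choose g h1 h2 h3 h4 h5 using hg
    obtain ⟨ψ, hψ⟩ := exists_glue hP g fun i j => by
      rw [h1 i _ (corner_mem_V P j m), h1 j _ (corner_mem_V P i m), fTet_corner_comm]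
    have hcomp : ∀ i, ψ.comp (cellMap P i) = g i := fun i => ContinuousMap.ext fun Y => hψ i Y
    refine ⟨ψ, fun Y hY => ?_, fun Y => ?_, fun u k hk => ?_, ?_⟩
    · obtain ⟨i, Z, hZ, rfl⟩ := mem_V_succ.1 hY
      rw [hψ, h1 i Z hZ]
    · obtain ⟨i, Z, rfl⟩ := exists_fTet_eq Y
      rw [hψ]
      exact h2 i Z
    · obtain ⟨k, rfl⟩ : ∃ k', k = k' + 1 := ⟨k - 1, by omega⟩
      rw [energyLevel_succ hP, energyLevel_succ hP]
      simp only [hcomp]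
      congr 1
      exact Finset.sum_congr rfl fun i _ => h3 i _ k (Nat.le_of_succ_le_succ hk)
    -- At least one of the four equally weighted pieces is zero, whence the ratio 3/4. It is not
    -- sharp, but any ratio below 1 suffices.
    · obtain ⟨i, hi⟩ := exists_notMem_range_fTet hP X
      rw [integral_selfSimilar]
      simp only [hψ]
      rw [← Finset.add_sum_erase _ _ (Finset.mem_univ i), h5 i hi]
      have := Finset.sum_le_card_nsmul (Finset.univ.erase i) (fun j => ∫ Y, g j Y ∂(mu P))
        ((3 / 4) ^ m) fun j _ => h4 j
      simp only [Finset.card_erase_of_mem (Finset.mem_univ i), Finset.card_univ,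
        Fintype.card_fin, nsmul_eq_mul] at this
      rw [show ((4 - 1 : ℕ) : ℝ) = 3 by norm_num] at this
      simp only [ContinuousMap.zero_apply, integral_zero, zero_add, pow_succ]
      linarith

/-! ### The domain of the Dirichlet form -/

/-- Monotonicity in the level reduces finite energy to boundedness. -/
theorem mem_domE_of_le (hP : AffineIndependent ℝ P) {u : C(Tet P, ℝ)} {c : ℝ}
    (h : ∀ m, energyLevel P m u u ≤ c) : u ∈ domE P :=
  ⟨_, tendsto_atTop_ciSup (energyLevel_mono hP u) ⟨c, by rintro _ ⟨m, rfl⟩; exact h m⟩⟩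

theorem exists_energyLevel_le (hP : AffineIndependent ℝ P) {u : C(Tet P, ℝ)} (hu : u ∈ domE P) :
    ∃ c, ∀ m, energyLevel P m u u ≤ c := by
  obtain ⟨e, he⟩ := hu
  exact ⟨e, fun m => (energyLevel_mono hP u).ge_of_tendsto he m⟩

theorem energyLevel_add_self (m : ℕ) (u v : C(Tet P, ℝ)) :
    energyLevel P m (u + v) (u + v) =
      energyLevel P m u u + 2 * energyLevel P m u v + energyLevel P m v v := by
  rw [energyLevel_add_left, energyLevel_add_right, energyLevel_add_right, energyLevel_comm m v u]
  ring

theorem smul_mem_domE {u : C(Tet P, ℝ)} (hu : u ∈ domE P) (c : ℝ) : c • u ∈ domE P := by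
  obtain ⟨e, he⟩ := hu
  refine ⟨c * (c * e), ?_⟩
  simp only [energyLevel_smul_left, energyLevel_smul_right]
  exact (he.const_mul c).const_mul c

theorem add_mem_domE (hP : AffineIndependent ℝ P) {u v : C(Tet P, ℝ)} (hu : u ∈ domE P)
    (hv : v ∈ domE P) : u + v ∈ domE P := by
  obtain ⟨c, hc⟩ := exists_energyLevel_le hP hu
  obtain ⟨d, hd⟩ := exists_energyLevel_le hP hv
  refine mem_domE_of_le hP (c := 2 * c + 2 * d) fun m => ?_
  -- Non-negativity of the energy of `u - v` bounds the cross term: `2 𝓔_m(u,v) ≤ 𝓔_m(u,u) +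
  -- 𝓔_m(v,v)`.
  have h := energyLevel_self_nonneg m (u + (-1 : ℝ) • v)
  rw [energyLevel_add_self, energyLevel_smul_right, energyLevel_smul_left,
    energyLevel_smul_right] at h
  rw [energyLevel_add_self]
  linarith [hc m, hd m]

/-- `dom 𝓔` as a linear subspace. -/
def domESubmodule (hP : AffineIndependent ℝ P) : Submodule ℝ C(Tet P, ℝ) where
  carrier := domE P
  add_mem' := add_mem_domE hP
  zero_mem' := mem_domE_of_le hP (c := 0) fun m => (energyLevel_zero_right m 0).le
  smul_mem' c _ hu := smul_mem_domE hu c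

theorem tendsto_energy (hP : AffineIndependent ℝ P) {u v : C(Tet P, ℝ)} (hu : u ∈ domE P)
    (hv : v ∈ domE P) : Tendsto (fun m => energyLevel P m u v) atTop (𝓝 (energy P u v)) := by
  refine tendsto_nhds_limUnder ?_
  obtain ⟨c, hc⟩ := hu
  obtain ⟨d, hd⟩ := hv
  -- Polarization: the mixed energies converge because those of `u`, `v` and `u + v` do.
  obtain ⟨e, he⟩ := add_mem_domE hP ⟨c, hc⟩ ⟨d, hd⟩
  refine ⟨1 / 2 * (e - c - d), (((he.sub hc).sub hd).const_mul (1 / 2)).congr fun m => ?_⟩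
  rw [energyLevel_add_self]
  ring

theorem mem_domE_of_eventually_const {m : ℕ} {ψ : C(Tet P, ℝ)}
    (h : ∀ u k, m ≤ k → energyLevel P k u ψ = energyLevel P m u ψ) : ψ ∈ domE P :=
  ⟨_, tendsto_const_nhds.congr' (eventually_atTop.2 ⟨m, fun k hk => (h ψ k hk).symm⟩)⟩

theorem energy_eq_of_eventually_const {m : ℕ} {u ψ : C(Tet P, ℝ)}
    (h : ∀ u k, m ≤ k → energyLevel P k u ψ = energyLevel P m u ψ) :
    energy P u ψ = energyLevel P m u ψ :=
  Tendsto.limUnder_eq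
    (tendsto_const_nhds.congr' (eventually_atTop.2 ⟨m, fun k hk => (h u k hk).symm⟩))

theorem energy_add_smul_right (hP : AffineIndependent ℝ P) {u v w : C(Tet P, ℝ)} (hu : u ∈ domE P)
    (hv : v ∈ domE P) (hw : w ∈ domE P) (c : ℝ) :
    energy P u (v + c • w) = energy P u v + c * energy P u w := by
  refine tendsto_nhds_unique (tendsto_energy hP hu (add_mem_domE hP hv (smul_mem_domE hw c))) ?_
  refine ((tendsto_energy hP hu hv).add ((tendsto_energy hP hu hw).const_mul c)).congr fun m => ?_
  rw [energyLevel_add_right, energyLevel_smul_right]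

/-- The energy `v ↦ 𝓔(u,v)` as a linear functional on `dom 𝓔`. -/
noncomputable def energyRight (hP : AffineIndependent ℝ P) {u : C(Tet P, ℝ)} (hu : u ∈ domE P) :
    domESubmodule hP →ₗ[ℝ] ℝ where
  toFun v := energy P u v
  map_add' v w := by
    simpa using energy_add_smul_right hP hu v.2 w.2 1
  map_smul' c v := by
    have h0 : energy P u 0 = 0 := by
      rw [energy_eq_of_eventually_const (m := 0) (by simp [energyLevel_zero_right]),
        energyLevel_zero_right]
    simpa [h0] using energy_add_smul_right hP hu (domESubmodule hP).zero_mem v.2 c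

/-! ### Normal derivatives and the Gauss–Green formula -/

theorem tendsto_integral_mul_zero {ψ : ℕ → C(Tet P, ℝ)} (h : ∀ m Y, ψ m Y ∈ Set.Icc 0 1)
    (hψ : ∀ m, ∫ Y, ψ m Y ∂(mu P) ≤ (3 / 4) ^ m) (g : C(Tet P, ℝ)) :
    Tendsto (fun m => ∫ Y, ψ m Y * g Y ∂(mu P)) atTop (𝓝 0) := by
  have hlim : Tendsto (fun m : ℕ => (3 / 4 : ℝ) ^ m * ‖g‖) atTop (𝓝 0) := by
    simpa using (tendsto_pow_atTop_nhds_zero_of_lt_one (by norm_num : (0 : ℝ) ≤ 3 / 4)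
      (by norm_num)).mul_const ‖g‖
  refine squeeze_zero_norm (fun m => ?_) hlim
  calc ‖∫ Y, ψ m Y * g Y ∂(mu P)‖ ≤ ∫ Y, ψ m Y * ‖g‖ ∂(mu P) := by
        refine norm_integral_le_of_norm_le ((integrable_of_continuous (ψ m)).mul_const _)
          (Eventually.of_forall fun Y => ?_)
        rw [norm_mul, Real.norm_of_nonneg (h m Y).1]
        exact mul_le_mul_of_nonneg_left (g.norm_coe_le_norm Y) (h m Y).1
    _ = (∫ Y, ψ m Y ∂(mu P)) * ‖g‖ := integral_mul_const _ _
    _ ≤ (3 / 4) ^ m * ‖g‖ := mul_le_mul_of_nonneg_right (hψ m) (norm_nonneg g)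

/-- The tents at `X` vanish on `V_0`, so they are admissible in the weak equation. Points outside
all `V_m` need no separate case: there the tent is zero on `V_m` and the normal difference is an
empty sum. -/
theorem tendsto_normalDiff_of_notMem (hP : AffineIndependent ℝ P) {u g : C(Tet P, ℝ)}
    (hg : IsLaplacian P u g) {X : Tet P} (hX : X ∉ V P 0) :
    Tendsto (normalDiff P u X) atTop (𝓝 0) := by
  choose ψ h1 h2 h3 h4 using fun m => exists_tent hP m X
  rw [← neg_zero]
  refine (tendsto_integral_mul_zero h2 h4 g).neg.congr fun m => ?_
  rw [← energyLevel_eq_normalDiff u (h1 m), ← energy_eq_of_eventually_const (h3 m), hg]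
  refine ⟨mem_domE_of_eventually_const (h3 m), fun Y hY => ?_⟩
  rw [h1 m Y (V_mono P m.zero_le hY), if_neg]
  rintro rfl
  exact hX hY

open Classical in
-- The difference `ψ_m - φ` vanishes on `V_0`. Testing with it shows that the normal difference is
-- exactly the claimed limit minus `∫ ψ_m g dμ`.
theorem tendsto_normalDiff_of_mem (hP : AffineIndependent ℝ P) {u g : C(Tet P, ℝ)}
    (hu : u ∈ domE P) (hg : IsLaplacian P u g) {X : Tet P} {φ : C(Tet P, ℝ)} (hφ : φ ∈ domE P)
    (hφ₀ : ∀ Y ∈ V P 0, φ Y = if Y = X then 1 else 0) :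
    Tendsto (normalDiff P u X) atTop (𝓝 (energy P u φ + ∫ Y, φ Y * g Y ∂(mu P))) := by
  choose ψ h1 h2 h3 h4 using fun m => exists_tent hP m X
  rw [← sub_zero (energy P u φ + _)]
  refine ((tendsto_integral_mul_zero h2 h4 g).const_sub _).congr fun m => ?_
  have hψ : ψ m ∈ domE P := mem_domE_of_eventually_const (h3 m)
  rw [← energyLevel_eq_normalDiff u (h1 m), ← energy_eq_of_eventually_const (h3 m)]
  have key := hg (ψ m + (-1 : ℝ) • φ) ⟨add_mem_domE hP hψ (smul_mem_domE hφ _), fun Y hY => by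
    simp [h1 m Y (V_mono P m.zero_le hY), hφ₀ Y hY]⟩
  have hint : ∫ Y, (ψ m + (-1 : ℝ) • φ) Y * g Y ∂(mu P) =
      ∫ Y, ψ m Y * g Y ∂(mu P) - ∫ Y, φ Y * g Y ∂(mu P) := by
    rw [← integral_sub (integrable_mul (ψ m) g) (integrable_mul φ g)]
    refine integral_congr_ae (Eventually.of_forall fun Y => ?_)
    simp only [ContinuousMap.add_apply, ContinuousMap.smul_apply, smul_eq_mul]
    ring
  rw [energy_add_smul_right hP hu hψ hφ, hint] at key
  linarith

theorem gaussGreen (hP : AffineIndependent ℝ P) {u g v : C(Tet P, ℝ)} (hu : u ∈ domE P)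
    (hg : IsLaplacian P u g) (hv : v ∈ domE P) :
    energy P u v = -(∫ X, g X * v X ∂(mu P)) + ∑ X ∈ V P 0, v X * normalDeriv P u X := by
  classical
  choose φ h1 _ h3 _ using exists_tent hP 0
  have hφ : ∀ X, φ X ∈ domE P := fun X => mem_domE_of_eventually_const (h3 X)
  have hn : ∀ X, normalDeriv P u X = energy P u (φ X) + ∫ Y, φ X Y * g Y ∂(mu P) := fun X =>
    (tendsto_normalDiff_of_mem hP hu hg (hφ X) (h1 X)).limUnder_eq
  -- The interpolant of the boundary values of `v`; `v - Φ` is the test function. It is formed in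
  -- the submodule so that linearity of `energyRight` distributes the energy over the sum.
  let Φ : domESubmodule hP := ∑ X ∈ V P 0, v X • (⟨φ X, hφ X⟩ : domESubmodule hP)
  have hΦ : (Φ : C(Tet P, ℝ)) = ∑ X ∈ V P 0, v X • φ X := by simp [Φ]
  have hΦE : energy P u Φ = ∑ X ∈ V P 0, v X * energy P u (φ X) := by
    change energyRight hP hu Φ = _
    simp only [Φ, map_sum, map_smul, smul_eq_mul]
    rfl
  have key := hg (v + (-1 : ℝ) • Φ) ⟨add_mem_domE hP hv (smul_mem_domE Φ.2 _), fun Y hY => by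
    have : ∑ X ∈ V P 0, v X * φ X Y = v Y := by
      rw [Finset.sum_eq_single Y (fun X _ hXY => by rw [h1 X Y hY, if_neg hXY.symm, mul_zero])
        fun h => absurd hY h, h1 Y Y hY, if_pos rfl, mul_one]
    simp [hΦ, ContinuousMap.sum_apply, this]⟩
  have hint : ∫ Y, (v + (-1 : ℝ) • (Φ : C(Tet P, ℝ))) Y * g Y ∂(mu P) =
      ∫ Y, g Y * v Y ∂(mu P) - ∑ X ∈ V P 0, v X * ∫ Y, φ X Y * g Y ∂(mu P) := by
    simp_rw [← integral_const_mul]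
    rw [← integral_finsetSum _ fun X _ => (integrable_mul (φ X) g).const_mul (v X),
      ← integral_sub (integrable_mul g v)
        (integrable_finsetSum _ fun X _ => (integrable_mul (φ X) g).const_mul (v X))]
    refine integral_congr_ae (Eventually.of_forall fun Y => ?_)
    simp only [hΦ, ContinuousMap.add_apply, ContinuousMap.smul_apply, ContinuousMap.sum_apply,
      smul_eq_mul, ← mul_assoc, ← Finset.sum_mul]
    ring
  rw [energy_add_smul_right hP hu hv Φ.2, hint, hΦE] at key
  simp only [hn, mul_add, Finset.sum_add_distrib]
  linarith

end SierpinskiTetrahedron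

theorem mainTheorem4 (P : Fin 4 → EuclideanSpace ℝ (Fin 3)) (hP : AffineIndependent ℝ P)
    (u : C(Tet P, ℝ)) (hu : u ∈ domLaplacian P) :
    (∀ X : Tet P, HasNormalDeriv P u X) ∧
    ∀ Δu : C(Tet P, ℝ), IsLaplacian P u Δu → ∀ v ∈ domE P,
      Tendsto (fun m => energyLevel P m u v) atTop (𝓝 (energy P u v)) ∧
      energy P u v =
        -(∫ X, Δu X * v X ∂(mu P)) + ∑ X ∈ V P 0, v X * normalDeriv P u X := by
  obtain ⟨huE, g, hg⟩ := hu
  -- One Laplacian `g` suffices for the normal derivatives, while the formula is proved for an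
  -- arbitrary `Δu`; uniqueness of the Laplacian is never needed.
  refine ⟨fun X => ?_, fun Δu hΔ v hv => ⟨tendsto_energy hP huE hv, gaussGreen hP huE hΔ hv⟩⟩
  by_cases hX : X ∈ V P 0
  · obtain ⟨φ, h1, -, h3, -⟩ := exists_tent hP 0 X
    exact ⟨_, tendsto_normalDiff_of_mem hP huE hg (mem_domE_of_eventually_const h3) h1⟩
  · exact ⟨0, tendsto_normalDiff_of_notMem hP hg hX⟩
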